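/- Let $k$ be a commutative noetherian ring and let $\mathcal C$ be the category whose objects are the finite sets and whose morphisms from $X$ to $Y$ are the correspondences, i.e. the subsets of $Y\times X$, composed as relations. For finite sets $X,Y$ let $k\mathcal C(Y,X)$ be the free $k$-module on the set $\mathcal C(Y,X)$ of correspondences from $X$ to $Y$. A correspondence functor over $k$ is a functor $M$ from $\mathcal C$ to the category of $k$-modules; equivalently, a $k$-linear functor on the $k$-linearization $k\mathcal C$. For finite sets $E,X$, write $k\mathcal C(X,E)M(E)\subseteq M(X)$ for the $k$-submodule generated by all elements $M(R)(m)$ with $R$ a correspondence from $E$ to $X$ and $m\in M(E)$; say that $M$ is generated by $M(E)$ if $M(X)=k\mathcal C(X,E)M(E)$ for every finite set $X$. For a correspondence functor $N$ and a finite set $Y$, put $$\overline N(Y)=N(Y)\Big/\sum_{Y'\subsetneq Y}k\mathcal C(Y,Y')N(Y'),$$ where the sum runs over the proper subsets $Y'$ of $Y$. Theorem. Let $N$ be a subfunctor of a correspondence functor $M$ over $k$. If $E$ and $Y$ are finite sets such that $M$ is generated by $M(E)$ and $\overline N(Y)\neq 0$, then $|Y|\leq 2^{|E|}$. -/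

import Mathlib

open CategoryTheory

universe u v w

/-- The category `𝒞` of finite sets and correspondences: the full subcategory of Mathlib's category
of sets and relations whose objects are the finite sets.  The composite `f ≫ g` relates `x` to `z`
iff some `y` is related to `x` by `f` and to `z` by `g`. -/
abbrev FinCorr : Type (u + 1) :=
  ObjectProperty.FullSubcategory fun X : RelCat.{u} => @Finite X

namespace FinCorr

/-- A finite set, as an object of the category of finite sets and correspondences. -/
def of (X : Type u) [h : Finite X] : FinCorr.{u} where
  obj := X
  property := h

/-- A correspondence between finite sets, as a morphism. -/
def ofRel {X Y : Type u} [Finite X] [Finite Y] (R : SetRel X Y) : of X ⟶ of Y :=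
  ObjectProperty.homMk (RelCat.Hom.ofRel R)

/-- The correspondence underlying a morphism. -/
def rel {X Y : Type u} [Finite X] [Finite Y] (f : of X ⟶ of Y) : SetRel X Y :=
  RelCat.Hom.rel f.hom

theorem rel_ofRel {X Y : Type u} [Finite X] [Finite Y] (R : SetRel X Y) :
    rel (ofRel R) = R := rfl

theorem ofRel_rel {X Y : Type u} [Finite X] [Finite Y] (f : of X ⟶ of Y) :
    ofRel (rel f) = f := rfl

theorem mem_rel_comp {X Y Z : Type u} [Finite X] [Finite Y] [Finite Z]
    (f : of X ⟶ of Y) (g : of Y ⟶ of Z) (x : X) (z : Z) :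
    (x, z) ∈ rel (f ≫ g) ↔ ∃ y, (x, y) ∈ rel f ∧ (y, z) ∈ rel g := Iff.rfl

theorem mem_rel_id {X : Type u} [Finite X] (x y : X) :
    (x, y) ∈ rel (𝟙 (of X)) ↔ x = y := Iff.rfl

end FinCorr

/-- A correspondence functor over `k`: a functor from finite sets and correspondences to
`k`-modules (equivalently, a `k`-linear functor on the `k`-linearization of that category). -/
abbrev CorrFunctor (k : Type v) [CommRing k] : Type (max (u + 1) v (w + 1)) :=
  FinCorr.{u} ⥤ ModuleCat.{w} k

namespace CorrFunctor

variable {k : Type v} [CommRing k]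

/-- The action `M(E) → M(X)` of a correspondence from `E` to `X`, as a `k`-linear map. -/
def act (M : CorrFunctor.{u, v, w} k) {E X : FinCorr.{u}} (R : E ⟶ X) :
    M.obj E →ₗ[k] M.obj X :=
  (M.map R).hom

/-- The submodule `k𝒞(X,E) M(E)` of `M(X)`: the `k`-linear combinations of elements `R · m`, where
`m ∈ M(E)` and `R` is a correspondence from `E` to `X`. -/
def imageFrom (M : CorrFunctor.{u, v, w} k) (E X : FinCorr.{u}) : Submodule k (M.obj X) :=
  Submodule.span k {x | ∃ (R : E ⟶ X) (m : M.obj E), M.act R m = x}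

/-- `M` is generated by `M(E)`: `M(X) = k𝒞(X,E) M(E)` for every finite set `X`. -/
def IsGeneratedBy (M : CorrFunctor.{u, v, w} k) (E : FinCorr.{u}) : Prop :=
  ∀ X : FinCorr.{u}, M.imageFrom E X = ⊤

/-- The sum of the submodules `k𝒞(Y,Y') M(Y')` of `M(Y)` over all proper subsets `Y'` of `Y`. -/
def properImages (M : CorrFunctor.{u, v, w} k) (Y : Type u) [Finite Y] :
    Submodule k (M.obj (FinCorr.of Y)) :=
  ⨆ (Y' : Set Y) (_ : Y' ≠ Set.univ), M.imageFrom (FinCorr.of Y') (FinCorr.of Y)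

/-- The quotient `M̄(Y)` of `M(Y)` by the sum of the `k𝒞(Y,Y') M(Y')`, `Y'` a proper subset. -/
abbrev bar (M : CorrFunctor.{u, v, w} k) (Y : Type u) [Finite Y] : Type w :=
  M.obj (FinCorr.of Y) ⧸ M.properImages Y

/-- A subfunctor of `M`: submodules `N(X)` of the `M(X)`, stable under all correspondences. -/
structure Sub (M : CorrFunctor.{u, v, w} k) where
  /-- The submodule `N(X)` of `M(X)`. -/
  obj : ∀ X : FinCorr.{u}, Submodule k (M.obj X)
  act_mem : ∀ {X Y : FinCorr.{u}} (R : X ⟶ Y) {m : M.obj X}, m ∈ obj X → M.act R m ∈ obj Y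

/-- A subfunctor, viewed as a correspondence functor. -/
def Sub.toFunctor {M : CorrFunctor.{u, v, w} k} (N : Sub M) : CorrFunctor.{u, v, w} k where
  obj X := ModuleCat.of k (N.obj X)
  map R := ModuleCat.ofHom ((M.act R).restrict fun _ hm => N.act_mem R hm)
  map_id X := by
    ext m
    simp [act, LinearMap.restrict_apply]
  map_comp R S := by
    ext m
    simp [act, LinearMap.restrict_apply]

end CorrFunctor

/-! Suppose `|Y| > 2^|E|`. Counting yields distinct families `A`, `B` of tuples in `Y` that no map
`Y → Set E` can tell apart. A correspondence from `E` to `Y` is such a map, and composing it with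
`pairing s t` sees `s` only through it; so summing `pairing s t` over `A` or over `B` gives the same
operator on `M(Y)`, hence on `N(Y)`. A maximal choice of `Q` gives `x = Q m`, nonzero in the
quotient of `N(Y)`, on which `pairing s t` acts as 1 if `s ≤ t` coordinatewise in the residual order
of `Q`, and as 0 otherwise. Taking `t` minimal in the symmetric difference of `A` and `B` forces `x
= 0` there. -/

open Finset in
/-- If `L` is smaller than `Y`, then some two distinct families of functions into `Y` have, for every
map `Y → L`, the same composites with that map, counted with multiplicity. -/
theorem exists_ne_finset_card_filter_comp_eq {Y : Type*} {L : Type*} [Fintype Y] [Fintype L]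
    [DecidableEq Y] [DecidableEq L] [Nonempty L] (h : Fintype.card L < Fintype.card Y) :
    ∃ (z : ℕ) (A B : Finset (Fin z → Y)), A ≠ B ∧
      ∀ (φ : Y → L) (ψ : Fin z → L),
        #{s ∈ A | φ ∘ s = ψ} = #{s ∈ B | φ ∘ s = ψ} := by
  set n := Fintype.card Y with hn
  set l := Fintype.card L with hl
  have hl0 : 0 < l := Fintype.card_pos
  have hn0 : 0 < n := hl0.trans h
  -- There are `2^(n^z)` families but at most `2^(n z l^n l^z)` tables of multiplicities; since `l <
  -- n`, the ratio of exponents tends to 0.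
  obtain ⟨z, hz, hz1⟩ : ∃ z : ℕ, n * z * (l ^ n * l ^ z) < n ^ z ∧ 1 ≤ z := by
    have hn0' : (0 : ℝ) < n := by exact_mod_cast hn0
    have hr : Filter.Tendsto (fun z : ℕ => (n * l ^ n : ℝ) * (z * ((l : ℝ) / n) ^ z))
        Filter.atTop (nhds 0) := by
      simpa using (tendsto_self_mul_const_pow_of_lt_one (r := (l : ℝ) / n) (by positivity)
        ((div_lt_one hn0').2 (by exact_mod_cast h))).const_mul (n * l ^ n : ℝ)
    obtain ⟨z, hz, hz1⟩ := ((hr.eventually (gt_mem_nhds one_pos)).and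
      (Filter.eventually_ge_atTop 1)).exists
    refine ⟨z, ?_, hz1⟩
    have hz' : (n : ℝ) * z * (l ^ n * l ^ z) < n ^ z := by
      rw [div_pow] at hz
      have hp : (0 : ℝ) < n ^ z := by positivity
      calc (n : ℝ) * z * (l ^ n * l ^ z)
          = (n * l ^ n * (z * (l ^ z / n ^ z))) * n ^ z := by field_simp
        _ < 1 * n ^ z := by gcongr
        _ = n ^ z := one_mul _
    exact_mod_cast hz'
  have hb : n ^ z + 1 ≤ 2 ^ (n * z) := by
    rw [pow_mul]
    exact Nat.succ_le_of_lt (Nat.pow_lt_pow_left Nat.lt_two_pow_self (by omega))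
  let Φ : Finset (Fin z → Y) → (Y → L) → (Fin z → L) → Fin (n ^ z + 1) := fun A φ ψ =>
    ⟨#{s ∈ A | φ ∘ s = ψ}, Nat.lt_succ_of_le ((card_le_univ _).trans (by simp [hn]))⟩
  have hcard : Fintype.card ((Y → L) → (Fin z → L) → Fin (n ^ z + 1)) <
      Fintype.card (Finset (Fin z → Y)) := by
    simp only [Fintype.card_fun, Fintype.card_finset, Fintype.card_fin, ← hn, ← hl]
    calc ((n ^ z + 1) ^ l ^ z) ^ l ^ n = (n ^ z + 1) ^ (l ^ n * l ^ z) := by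
          rw [← pow_mul, mul_comm]
      _ ≤ (2 ^ (n * z)) ^ (l ^ n * l ^ z) := Nat.pow_le_pow_left hb _
      _ = 2 ^ (n * z * (l ^ n * l ^ z)) := (pow_mul _ _ _).symm
      _ < 2 ^ n ^ z := Nat.pow_lt_pow_right one_lt_two hz
  obtain ⟨A, B, hAB, hΦ⟩ := Fintype.exists_ne_map_eq_of_card_lt Φ hcard
  exact ⟨z, A, B, hAB, fun φ ψ => congrArg Fin.val (congrFun (congrFun hΦ φ) ψ)⟩

open Finset in
theorem Finset.sum_comp_eq_of_card_filter_eq {ι κ G : Type*} [Fintype κ] [DecidableEq κ]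
    [AddCommMonoid G] {A B : Finset ι} {g : ι → κ}
    (h : ∀ j, #{i ∈ A | g i = j} = #{i ∈ B | g i = j}) (f : κ → G) :
    ∑ i ∈ A, f (g i) = ∑ i ∈ B, f (g i) := by
  rw [← Finset.sum_fiberwise' A g f, ← Finset.sum_fiberwise' B g f]
  simp [h]

/-- Every nonzero term other than `f t` occurs in both sums or in neither, so cancellation leaves `f
t` alone. -/
theorem Finset.eq_zero_of_sum_eq_sum {ι G : Type*} [AddCommGroup G] {A B : Finset ι} {f : ι → G}
    {t : ι} (h : ∑ s ∈ A, f s = ∑ s ∈ B, f s) (ht : ¬ (t ∈ A ↔ t ∈ B))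
    (hf : ∀ s, s ≠ t → f s ≠ 0 → (s ∈ A ↔ s ∈ B)) : f t = 0 := by
  classical
  wlog htA : t ∈ A generalizing A B
  · exact this h.symm (fun hc => ht hc.symm) (fun s hs hs' => (hf s hs hs').symm) (by tauto)
  have htB : t ∉ B := by tauto
  by_contra hft
  have hAB : A.filter (f · ≠ 0) = insert t (B.filter (f · ≠ 0)) := by
    ext s
    by_cases hs : s = t
    · subst hs
      simp [htA, hft]
    · simp only [Finset.mem_filter, Finset.mem_insert, hs, false_or]
      exact ⟨fun ⟨h1, h2⟩ => ⟨(hf s hs h2).1 h1, h2⟩, fun ⟨h1, h2⟩ => ⟨(hf s hs h2).2 h1, h2⟩⟩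
  rw [← Finset.sum_filter_ne_zero A, hAB, Finset.sum_insert (by simp [htB]),
    Finset.sum_filter_ne_zero] at h
  exact hft (by simpa using h)

namespace FinCorr

theorem hom_ext {X Y : Type u} [Finite X] [Finite Y] {f g : of X ⟶ of Y}
    (h : ∀ x y, (x, y) ∈ rel f ↔ (x, y) ∈ rel g) : f = g := by
  have : rel f = rel g := Set.ext fun p => h p.1 p.2
  rw [← ofRel_rel f, this, ofRel_rel]

/-- The reflexive correspondence on `Y` consisting of the diagonal and the pairs `(s i, t i)`. -/
def pairing {Y : Type u} [Finite Y] {ι : Type*} (s t : ι → Y) : of Y ⟶ of Y :=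
  ofRel {p | p.1 = p.2 ∨ ∃ i, s i = p.1 ∧ t i = p.2}

theorem mem_rel_pairing {Y : Type u} [Finite Y] {ι : Type*} {s t : ι → Y} {x y : Y} :
    (x, y) ∈ rel (pairing s t) ↔ x = y ∨ ∃ i, s i = x ∧ t i = y := Iff.rfl

/-- The largest correspondence `R` with `Q ≫ R ≤ Q`. -/
def residual {X Y : Type u} [Finite X] [Finite Y] (Q : of X ⟶ of Y) (y z : Y) : Prop :=
  ∀ x, (x, y) ∈ rel Q → (x, z) ∈ rel Q

theorem comp_eq_self_of_le_residual {X Y : Type u} [Finite X] [Finite Y] {Q : of X ⟶ of Y}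
    {P : of Y ⟶ of Y} (hP : ∀ y, (y, y) ∈ rel P)
    (h : ∀ y z, (y, z) ∈ rel P → residual Q y z) : Q ≫ P = Q :=
  hom_ext fun x z => ⟨fun ⟨y, hxy, hyz⟩ => h y z hyz x hxy, fun hxz => ⟨z, hxz, hP z⟩⟩

end FinCorr

namespace CorrFunctor

open FinCorr

variable {k : Type v} [CommRing k]

theorem act_comp (M : CorrFunctor.{u, v, w} k) {X Y Z : FinCorr.{u}} (f : X ⟶ Y) (g : Y ⟶ Z)
    (m : M.obj X) : M.act (f ≫ g) m = M.act g (M.act f m) := by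
  simp [act]

theorem act_id (M : CorrFunctor.{u, v, w} k) (X : FinCorr.{u}) (m : M.obj X) :
    M.act (𝟙 X) m = m := by
  simp [act]

theorem Sub.coe_toFunctor_act {M : CorrFunctor.{u, v, w} k} (N : Sub M) {X Y : FinCorr.{u}}
    (f : X ⟶ Y) (m : N.toFunctor.obj X) :
    (show N.obj Y from N.toFunctor.act f m : M.obj Y) = M.act f (show N.obj X from m).1 := rfl

/-- A correspondence with two equal columns factors through a proper subset. -/
theorem act_mem_properImages_of_residual (M : CorrFunctor.{u, v, w} k) {X Y : Type u} [Finite X]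
    [Finite Y] {Q : of X ⟶ of Y} {a b : Y} (hne : a ≠ b) (hab : residual Q a b)
    (hba : residual Q b a) (m : M.obj (of X)) : M.act Q m ∈ M.properImages Y := by
  let Y' : Set Y := {y | y ≠ a}
  have hY' : Y' ≠ Set.univ := fun h => absurd (h ▸ Set.mem_univ a : a ∈ Y') (by simp [Y'])
  let f : of X ⟶ of Y' := ofRel {p | (p.1, p.2.1) ∈ rel Q}
  let g : of Y' ⟶ of Y := ofRel {p | p.1.1 = p.2 ∨ (p.1.1 = b ∧ p.2 = a)}
  have hQ : Q = f ≫ g := by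
    refine hom_ext fun x y => ⟨fun h => ?_, ?_⟩
    · by_cases hy : y = a
      · subst hy
        exact ⟨⟨b, hne.symm⟩, hab x h, Or.inr ⟨rfl, rfl⟩⟩
      · exact ⟨⟨y, hy⟩, h, Or.inl rfl⟩
    · rintro ⟨⟨y', hy'⟩, hx, h | ⟨h, h'⟩⟩
      · obtain rfl : y' = y := h
        exact hx
      · obtain rfl : y' = b := h
        obtain rfl : y = a := h'
        exact hba x hx
  have : M.act Q m ∈ M.imageFrom (of Y') (of Y) := by
    rw [hQ, act_comp]
    exact Submodule.subset_span ⟨g, _, rfl⟩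
  exact Submodule.mem_iSup_of_mem Y' (Submodule.mem_iSup_of_mem hY' this)

/-- Two families of maps into `Y` which become equal, with multiplicity, after composition with every
map to the power set of `E` define the same operator on a functor generated by its value at `E`. -/
theorem sum_act_pairing_eq {M : CorrFunctor.{u, v, w} k} {E Y : Type u} [Finite E] [Fintype Y]
    (hM : M.IsGeneratedBy (of E)) {ι : Type} [Fintype ι] [DecidableEq ι] [Fintype (Set E)]
    [DecidableEq (Set E)] {A B : Finset (ι → Y)}
    (h : ∀ (φ : Y → Set E) (ψ : ι → Set E),
      (A.filter (φ ∘ · = ψ)).card = (B.filter (φ ∘ · = ψ)).card)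
    (t : ι → Y) (m : M.obj (of Y)) :
    ∑ s ∈ A, M.act (pairing s t) m = ∑ s ∈ B, M.act (pairing s t) m := by
  have hm : m ∈ M.imageFrom (of E) (of Y) := hM (of Y) ▸ Submodule.mem_top
  induction hm using Submodule.span_induction with
  | zero => simp
  | add x y _ _ hx hy => simp only [map_add, Finset.sum_add_distrib, hx, hy]
  | smul a x _ hx => simp only [map_smul, ← Finset.smul_sum, hx]
  | mem x hx =>
    obtain ⟨S, e, rfl⟩ := hx
    let φ : Y → Set E := fun y => {e | (e, y) ∈ rel S}
    let F : (ι → Set E) → (of E ⟶ of Y) := fun ψ =>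
      ofRel {p | (p.1, p.2) ∈ rel S ∨ ∃ i, p.1 ∈ ψ i ∧ t i = p.2}
    have hF : ∀ s : ι → Y, S ≫ pairing s t = F (φ ∘ s) := fun s => hom_ext fun x y => by
      constructor
      · rintro ⟨y', hx, h | ⟨i, rfl, rfl⟩⟩
        · obtain rfl : y' = y := h
          exact Or.inl hx
        · exact Or.inr ⟨i, hx, rfl⟩
      · rintro (hx | ⟨i, hx, rfl⟩)
        · exact ⟨y, hx, Or.inl rfl⟩
        · exact ⟨s i, hx, Or.inr ⟨i, rfl, rfl⟩⟩
    simp only [← act_comp, hF]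
    exact Finset.sum_comp_eq_of_card_filter_eq (h φ) fun ψ => M.act (F ψ) e

/-- If the evaluation at `Y` is not exhausted by proper subsets, some element outside `properImages`
is of the form `Q m`, is fixed by the reflexive correspondences inside the residual of `Q`, and is
sent into `properImages` by all other reflexive correspondences. -/
theorem exists_act_notMem_properImages (M : CorrFunctor.{u, v, w} k) {Y : Type u} [Finite Y]
    (h : Nontrivial (M.bar Y)) :
    ∃ (Q : of Y ⟶ of Y) (m : M.obj (of Y)), M.act Q m ∉ M.properImages Y ∧
      ∀ P : of Y ⟶ of Y, (∀ y, (y, y) ∈ rel P) →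
        (¬ ∀ y z, (y, z) ∈ rel P → residual Q y z) →
        M.act P (M.act Q m) ∈ M.properImages Y := by
  have hne : M.properImages Y ≠ ⊤ := Submodule.Quotient.nontrivial_iff.1 h
  obtain ⟨m₀, -, hm₀⟩ := SetLike.exists_of_lt hne.lt_top
  -- For `Q` maximal here and `P` reflexive, `Q ≫ P` contains `Q`; if it is strictly larger, it
  -- sends everything into `properImages`.
  let alive : Set (Set (Y × Y)) := {Q | (∀ y, (y, y) ∈ Q) ∧
    ∃ m : M.obj (of Y), M.act (ofRel Q : of Y ⟶ of Y) m ∉ M.properImages Y}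
  have hid : rel (𝟙 (of Y)) ∈ alive := ⟨fun _ => rfl, m₀, by rwa [ofRel_rel, act_id]⟩
  obtain ⟨Q, ⟨hQ, m, hm⟩, hmax⟩ := (Set.toFinite alive).exists_maximal ⟨_, hid⟩
  refine ⟨ofRel Q, m, hm, fun P hP hPQ => ?_⟩
  by_contra hcon
  rw [← act_comp] at hcon
  have hle : Q ≤ rel (ofRel Q ≫ P : of Y ⟶ of Y) := fun p hp => ⟨p.2, hp, hP p.2⟩
  have := hmax (y := rel (ofRel Q ≫ P : of Y ⟶ of Y))
    ⟨fun y => ⟨y, hQ y, hP y⟩, m, by rwa [ofRel_rel]⟩ hle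
  exact hPQ fun y z hyz x hxy => this ⟨y, hxy, hyz⟩

end CorrFunctor

open FinCorr CorrFunctor in
theorem mainTheorem6 {k : Type v} [CommRing k] [IsNoetherianRing k]
    (M : CorrFunctor.{u, v, w} k) (N : CorrFunctor.Sub M)
    (E Y : Type u) [Finite E] [Finite Y]
    (hM : M.IsGeneratedBy (FinCorr.of E))
    (hN : Nontrivial (N.toFunctor.bar Y)) :
    Nat.card Y ≤ 2 ^ Nat.card E := by
  classical
  by_contra! hlt
  have := Fintype.ofFinite Y
  have := Fintype.ofFinite E
  obtain ⟨z, A, B, hAB, hcard⟩ := exists_ne_finset_card_filter_comp_eq (Y := Y) (L := Set E)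
    (by simpa [Nat.card_eq_fintype_card] using hlt)
  obtain ⟨Q, m, hm, hkill⟩ := N.toFunctor.exists_act_notMem_properImages hN
  set x := N.toFunctor.act Q m with hx
  have hanti : ∀ a b, residual Q a b → residual Q b a → a = b := fun a b hab hba => by
    by_contra hne
    exact hm (N.toFunctor.act_mem_properImages_of_residual hne hab hba m)
  let below : (Fin z → Y) → (Fin z → Y) → Prop := fun s t => ∀ i, residual Q (s i) (t i)
  have hact : ∀ s t : Fin z → Y, Submodule.Quotient.mk (p := N.toFunctor.properImages Y)
      (N.toFunctor.act (pairing s t) x) =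
        if below s t then Submodule.Quotient.mk x else 0 := fun s t => by
    split_ifs with hst
    · rw [hx, ← act_comp, comp_eq_self_of_le_residual (P := pairing s t) fun y => Or.inl rfl]
      rintro y z (h | ⟨i, rfl, rfl⟩)
      · obtain rfl : y = z := h
        exact fun _ => id
      · exact hst i
    · rw [Submodule.Quotient.mk_eq_zero]
      exact hkill _ (fun y => Or.inl rfl) fun h => hst fun i => h _ _ (Or.inr ⟨i, rfl, rfl⟩)
  let lt : (Fin z → Y) → (Fin z → Y) → Prop := fun s t => below s t ∧ s ≠ t
  have : IsTrans _ lt := ⟨fun a b c hab hbc =>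
    ⟨fun i x hx => hbc.1 i x (hab.1 i x hx), by
      rintro rfl
      exact hab.2 (funext fun i => hanti _ _ (hab.1 i) (hbc.1 i))⟩⟩
  have : Std.Irrefl lt := ⟨fun a ha => ha.2 rfl⟩
  have hwf : WellFounded lt := Finite.wellFounded_of_trans_of_irrefl lt
  obtain ⟨t, ht, hmin⟩ := hwf.has_min {t | ¬ (t ∈ A ↔ t ∈ B)} (by
    by_contra hemp
    rw [Set.not_nonempty_iff_eq_empty, Set.eq_empty_iff_forall_notMem] at hemp
    exact hAB (Finset.ext fun t => not_not.1 (hemp t)))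
  have hsum : ∑ s ∈ A, N.toFunctor.act (pairing s t) x =
      ∑ s ∈ B, N.toFunctor.act (pairing s t) x := by
    -- Only `M` is generated at `E`, so the identity is proved in `M(Y)` and pulled back along the
    -- inclusion of `N(Y)`.
    apply Subtype.ext
    have h := sum_act_pairing_eq hM hcard t (show N.obj (of Y) from x).1
    simp only [← N.coe_toFunctor_act] at h
    have hcoe (C : Finset (Fin z → Y)) := map_sum (N.obj (of Y)).subtype
      (fun s => show N.obj (of Y) from N.toFunctor.act (pairing s t) x) C
    exact (hcoe A).trans (h.trans (hcoe B).symm)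
  have hq := congrArg (N.toFunctor.properImages Y).mkQ hsum
  simp only [map_sum, Submodule.mkQ_apply, hact] at hq
  have hzero := Finset.eq_zero_of_sum_eq_sum hq ht fun s hst hs => by
    by_contra hcon
    exact hmin s hcon ⟨by_contra fun hb => hs (if_neg hb), hst⟩
  rw [if_pos (show below t t from fun i y hy => hy), Submodule.Quotient.mk_eq_zero] at hzero
  exact hm hzero
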